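/- **Setting.** Let $G$ be a connected and simply connected topological group whose topology is induced by a proper left-invariant metric $d$, and let $(D_\lambda)_{\lambda>0}$ be a one-parameter group of automorphisms of $G$ with $d(D_\lambda g,D_\lambda h)=\lambda\, d(g,h)$. Let $\Gamma<G$ be a uniform lattice with $D_\lambda[\Gamma]\subseteq\Gamma$ for some $\lambda>1$, and let $V\subseteq G$ be a Borel, relatively compact left-fundamental domain of $\Gamma$ (that is, $G=\bigsqcup_{\gamma\in\Gamma}\gamma V$) with $e$ in the interior of $V$. For $\lambda>1$ and $M\subseteq\Gamma$ put $V_\lambda(0,M)=M\cdot V$ and $V_\lambda(n,M)=D_\lambda[(V_\lambda(n-1,M)\cap\Gamma)\cdot V]$ for $n\ge1$. Let $\lambda_0>1$ be a stretch factor: $D:=D_{\lambda_0}$ maps $\Gamma$ into $\Gamma$, and there are $C_->0$, $s\in\mathbb N_0$ and $z\in\Gamma$ such that $D^n[\{g\in G: d(g,z)<C_-\}]\subseteq V_{\lambda_0}(s+n,\{e\})$ for all $n\ge1$. Write $V(n,M)=V_{\lambda_0}(n,M)$. Let $\mathcal A$ be a finite alphabet and $S_0:\mathcal A\to\mathcal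 A^{D[V]\cap\Gamma}$ a substitution rule. A patch is a map $P:M\to\mathcal A$ with support $M\subseteq\Gamma$. The substitution map $S$ sends $P$ to the patch with support $V(1,M)\cap\Gamma$ given by $S(P)(D(\gamma)\eta)=S_0(P(\gamma))(\eta)$ for $\gamma\in M$, $\eta\in D[V]\cap\Gamma$; in particular it maps $\mathcal A^\Gamma$ to itself. Letters are identified with patches supported on $\{e\}$. Write $P\prec Q$ for patches $P$, $Q$ with supports $M$, $K$ if there is $\gamma\in\Gamma$ with $\gamma M\subseteq K$ and $Q(\gamma\eta)=P(\eta)$ for all $\eta\in M$. For $\omega\in\mathcal A^\Gamma$ let $W(\omega)$ be the set of finite patches $P\prec\omega$, and let $W(S)$ be the set of finite patches $P$ with $P\prec S^n(a)$ for some $n\ge1$, $a\in\mathcal A$ (the legal patches). Put $\Omega(S)=\{\omega\in\mathcal A^\Gamma: W(\omega)\subseteq W(S)\}$. The substitution is primitive if for some $L\ge1$ one has $a\prec S^L(b)$ for all $a,b\in\mathcal A$. Let $B(e,r)=\{\gamma\in\Gamma: d(\gamma,e)<r\}$, let $\Gamma$ act on $\mathcal A^\Gamma$ by $(\gamma\omega)(\eta)=\omega(\gamma^{-1}\eta)$,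 let $\mathrm{Orb}(\omega)=\{\gamma\omega:\gamma\in\Gamma\}$, equip $\mathcal A^\Gamma$ with the metric $\inf\{\tfrac1{r+1}: r\ge0,\ \omega|_{B(e,r)}=\rho|_{B(e,r)}\}$, and let $\delta_H$ be the induced Hausdorff metric. A testing tuple $(T,N_T)$ consists of a finite $T\subseteq\Gamma$ such that for every $r>0$ there is $N_r$ such that for all $n\ge N_r$ and $x\in\Gamma$ there is $\gamma\in\Gamma$ with $xB(e,r)\subseteq D^n(\gamma)V(n,T)$, and of the smallest integer $N_T=m\ge1$ such that for every $x\in\Gamma$ there is $\gamma\in\Gamma$ with $xT\subseteq D^m(\gamma)V(m,T)$. The directed graph $G_S(T,N_T)$ has vertex set $\mathcal A^T$ and an edge from $P$ to $Q$ if and only if $Q\prec S^{N_T}(P)$ and $P,Q\notin W(S)$. A Schrödinger operator of finite range is a family $(H_\omega)_{\omega\in\mathcal A^\Gamma}$ of self-adjoint operators on $\ell^2(\Gamma)$ of the form $(H_\omega\psi)(\gamma)=\sum_{\eta\in B}t_\eta(\gamma^{-1}\omega)\psi(\gamma\eta)$ with $B=B^{-1}\subseteq\Gamma$ finite and $t_\eta:\mathcal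 A^\Gamma\to\mathbb C$ continuous with $t_\eta(\omega)=\overline{t_{\eta^{-1}}(\eta^{-1}\omega)}$. **Theorem.** Suppose that the substitution is primitive. Then there exist $C>0$ and $M_1\ge0$ such that for every $\omega_0\in\mathcal A^\Gamma$ satisfying at least one of the conditions 1. for all Schrödinger operators $H$ of finite range and all $\omega\in\Omega(S)$, $\lim_{n\to\infty}\sigma(H_{S^n(\omega_0)})=\sigma(H_\omega)$ in the Hausdorff metric of compact subsets of $\mathbb R$; 2. $\lim_{n\to\infty}\delta_H\big(\overline{\mathrm{Orb}(S^n(\omega_0))},\Omega(S)\big)=0$; 3. for some testing tuple $(T,N_T)$, no directed path in $G_S(T,N_T)$ starting in a vertex of $W(\omega_0)\cap\mathcal A^T$ contains a closed subpath (of positive length); 4. for some testing tuple $(T,N_T)$, every directed path in $G_S(T,N_T)$ starting in a vertex of $W(\omega_0)\cap\mathcal A^T$ has length strictly less than $|\mathcal A^T|$; one has $$\delta_H\big(\overline{\mathrm{Orb}(S^n(\omega_0))},\Omega(S)\big)\le\frac{C}{\lambda_0^n}\qquad\text{for all integers } n\ge M_1 .$$ -/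

import Mathlib

open Set Filter Topology

noncomputable section

namespace SymbolicSubstitution

/-! ## Configurations -/

/-- The configuration space `A^Γ`, where `Γ` is a subgroup of a metric group `G`. -/
def Config {G : Type*} [Group G] (Γ : Subgroup G) (A : Type*) : Type _ := Γ → A

section Configurations

variable {G : Type*} [Group G] [MetricSpace G] {Γ : Subgroup G} {A : Type*}

/-- `ω` and `ρ` agree on the open ball `B(e, r)` of `Γ`. -/
def AgreeOn (r : ℝ) (ω ρ : Config Γ A) : Prop :=
  ∀ γ : Γ, dist γ 1 < r → ω γ = ρ γ

/-- `inf { 1 / (r + 1) | r ≥ 0, ω and ρ agree on B(e, r) }`. -/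
def configDist (ω ρ : Config Γ A) : ℝ :=
  sInf {x : ℝ | ∃ r : ℝ, 0 ≤ r ∧ AgreeOn r ω ρ ∧ x = 1 / (r + 1)}

theorem configDist_bddBelow (ω ρ : Config Γ A) :
    BddBelow {x : ℝ | ∃ r : ℝ, 0 ≤ r ∧ AgreeOn r ω ρ ∧ x = 1 / (r + 1)} := by
  refine ⟨0, ?_⟩
  rintro x ⟨r, hr, -, rfl⟩
  positivity

theorem configDist_nonempty (ω ρ : Config Γ A) :
    {x : ℝ | ∃ r : ℝ, 0 ≤ r ∧ AgreeOn r ω ρ ∧ x = 1 / (r + 1)}.Nonempty := by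
  refine ⟨1 / (0 + 1), 0, le_rfl, ?_, rfl⟩
  intro γ hγ
  exact absurd hγ (not_lt.mpr dist_nonneg)

theorem configDist_nonneg (ω ρ : Config Γ A) : 0 ≤ configDist ω ρ := by
  apply Real.sInf_nonneg
  rintro x ⟨r, hr, -, rfl⟩
  positivity

theorem configDist_lt_iff {ω ρ : Config Γ A} {ε : ℝ} :
    configDist ω ρ < ε ↔ ∃ r : ℝ, 0 ≤ r ∧ AgreeOn r ω ρ ∧ 1 / (r + 1) < ε := by
  constructor
  · intro h
    obtain ⟨x, ⟨r, hr, ha, rfl⟩, hx⟩ := exists_lt_of_csInf_lt (configDist_nonempty ω ρ) h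
    exact ⟨r, hr, ha, hx⟩
  · rintro ⟨r, hr, ha, hx⟩
    exact lt_of_le_of_lt (csInf_le (configDist_bddBelow ω ρ) ⟨r, hr, ha, rfl⟩) hx

theorem configDist_self (ω : Config Γ A) : configDist ω ω = 0 := by
  refine le_antisymm (le_of_forall_pos_lt_add ?_) (configDist_nonneg ω ω)
  intro ε hε
  rw [zero_add, configDist_lt_iff]
  refine ⟨1 / ε, by positivity, fun _ _ => rfl, ?_⟩
  rw [div_lt_iff₀ (by positivity)]
  have : ε * (1 / ε + 1) = 1 + ε := by field_simp
  linarith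

theorem configDist_comm (ω ρ : Config Γ A) : configDist ω ρ = configDist ρ ω := by
  unfold configDist AgreeOn
  simp only [eq_comm]

theorem configDist_triangle (ω ρ τ : Config Γ A) :
    configDist ω τ ≤ configDist ω ρ + configDist ρ τ := by
  apply le_of_forall_pos_lt_add
  intro ε hε
  obtain ⟨r, hr, har, hxr⟩ :=
    configDist_lt_iff.1 (show configDist ω ρ < configDist ω ρ + ε by linarith)
  obtain ⟨s, hs, has, hxs⟩ :=
    configDist_lt_iff.1 (show configDist ρ τ < configDist ρ τ + ε by linarith)
  have h1 := configDist_nonneg ω ρ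
  have h2 := configDist_nonneg ρ τ
  rw [configDist_lt_iff]
  refine ⟨min r s, le_min hr hs, fun γ hγ =>
    (har γ (lt_of_lt_of_le hγ (min_le_left _ _))).trans
      (has γ (lt_of_lt_of_le hγ (min_le_right _ _))), ?_⟩
  rcases min_choice r s with h | h <;> rw [h] <;> linarith

theorem eq_of_configDist_eq_zero {ω ρ : Config Γ A} (h : configDist ω ρ = 0) : ω = ρ := by
  funext γ
  have hd : (0 : ℝ) ≤ dist γ 1 := dist_nonneg
  obtain ⟨r, hr, ha, hx⟩ := configDist_lt_iff.1
    (show configDist ω ρ < 1 / (dist γ 1 + 1) by rw [h]; positivity)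
  refine ha γ ?_
  have := (one_div_lt_one_div (by positivity) (by positivity)).1 hx
  linarith

/-- The configuration space as a metric space; topological notions on configurations (closure,
continuity, Hausdorff distance) refer to this metric. -/
instance : MetricSpace (Config Γ A) where
  dist := configDist
  dist_self := configDist_self
  dist_comm := configDist_comm
  dist_triangle := configDist_triangle
  eq_of_dist_eq_zero := eq_of_configDist_eq_zero

/-- Left translation `(γ ω)(η) = ω (γ⁻¹ η)`. -/
def shift (γ : Γ) (ω : Config Γ A) : Config Γ A := fun η => ω (γ⁻¹ * η)

/-- The closure of the orbit `{γ ω | γ ∈ Γ}`. -/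
def orbitClosure (ω : Config Γ A) : Set (Config Γ A) :=
  closure (Set.range fun γ : Γ => shift γ ω)

end Configurations

/-! ## Patches -/

/-- A patch `P : M → A` with `M ⊆ Γ`, encoded as `P : Γ → Option A`, with `P γ = none` exactly
for `γ ∉ M`. -/
def Patch {G : Type*} [Group G] (Γ : Subgroup G) (A : Type*) : Type _ := Γ → Option A

namespace Patch

variable {G : Type*} [Group G] {Γ : Subgroup G} {A : Type*}

/-- The support of a patch. -/
def support (P : Patch Γ A) : Set Γ := {γ | P γ ≠ none}

/-- `P ≺ Q`: some translate `γ M` of the support `M` of `P` is contained in the support of `Q`,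
and `Q (γ η) = P η` for `η ∈ M`. -/
def IsSubpatch (P Q : Patch Γ A) : Prop :=
  ∃ γ : Γ, ∀ η ∈ P.support, Q (γ * η) = P η

/-- A configuration, as a patch with support `Γ`. -/
def ofConfig (ω : Config Γ A) : Patch Γ A := fun γ => some (ω γ)

open Classical in
/-- A letter, as a patch with support `{e}`. -/
def letter (a : A) : Patch Γ A := fun γ => if γ = 1 then some a else none

end Patch

/-- The dictionary `W(ω)`: all finite subpatches of `ω`. -/
def dictionary {G : Type*} [Group G] {Γ : Subgroup G} {A : Type*} (ω : Config Γ A) :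
    Set (Patch Γ A) :=
  {P | P.support.Finite ∧ P.IsSubpatch (Patch.ofConfig ω)}

/-- The set `A^K` of patches with finite support `K`. -/
abbrev PatchOn {G : Type*} [Group G] {Γ : Subgroup G} (A : Type*) (K : Finset Γ) : Type _ :=
  {P : Patch Γ A // P.support = (K : Set Γ)}

/-! ## Dilation data -/

/-- A dilation datum `(G, d, (D_l)_{l > 0}, Γ, V)`; the group `G` and its metric `d` are given by
the instances.  Values `D l` for `l ≤ 0` are irrelevant.  Local compactness, second countability
and the Hausdorff property follow from properness of the metric. -/
structure DilationDatum (G : Type*) [Group G] [MetricSpace G] where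
  topologicalGroup : IsTopologicalGroup G
  simplyConnected : SimplyConnectedSpace G
  proper : ProperSpace G
  left_invariant : ∀ g x y : G, dist (g * x) (g * y) = dist x y
  /-- the dilation family -/
  D : ℝ → (G ≃* G)
  D_mul : ∀ l m : ℝ, 0 < l → 0 < m → ∀ g : G, D (l * m) g = D l (D m g)
  D_dist : ∀ l : ℝ, 0 < l → ∀ g h : G, dist (D l g) (D l h) = l * dist g h
  /-- the uniform lattice -/
  Γ : Subgroup G
  discrete : DiscreteTopology Γ
  cocompact : CompactSpace (G ⧸ Γ)
  exists_D_mem : ∃ l : ℝ, 1 < l ∧ ∀ γ ∈ Γ, D l γ ∈ Γ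
  /-- the fundamental domain -/
  V : Set G
  V_borel : @MeasurableSet G (borel G) V
  V_relCompact : IsCompact (closure V)
  V_fundamental : ∀ g : G, ∃! γ : Γ, (γ : G)⁻¹ * g ∈ V
  one_mem_interior_V : (1 : G) ∈ interior V

namespace DilationDatum

variable {G : Type*} [Group G] [MetricSpace G] (𝒟 : DilationDatum G)

/-- The product set `M · V` for `M ⊆ Γ`. -/
def tile (M : Set 𝒟.Γ) : Set G := {g | ∃ γ ∈ M, ∃ v ∈ 𝒟.V, g = (γ : G) * v}

/-- The sets `V_l(n, M)`: `V_l(0, M) = M · V` and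
`V_l(n + 1, M) = D_l[(V_l(n, M) ∩ Γ) · V]`. -/
def VSet (l : ℝ) : ℕ → Set 𝒟.Γ → Set G
  | 0, M => 𝒟.tile M
  | n + 1, M => 𝒟.D l '' 𝒟.tile {γ | (γ : G) ∈ VSet l n M}

/-- `l` is sufficiently large relative to `V`.  The ball is a ball of `G`. -/
def SufficientlyLarge (l : ℝ) : Prop :=
  ∃ C : ℝ, 0 < C ∧ ∃ (s : ℕ) (z : 𝒟.Γ), ∀ n : ℕ, 1 ≤ n →
    (𝒟.D l)^[n] '' Metric.ball (z : G) C ⊆ 𝒟.VSet l (s + n) {1}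

/-- `l` is a stretch factor associated with the dilation datum. -/
structure IsStretchFactor (l : ℝ) : Prop where
  one_lt : 1 < l
  map_mem : ∀ γ ∈ 𝒟.Γ, 𝒟.D l γ ∈ 𝒟.Γ
  sufficientlyLarge : 𝒟.SufficientlyLarge l

/-- `K ⊆ D_l^n(γ) V_l(n, T)` for some `γ ∈ Γ`. -/
def Covered (l : ℝ) (n : ℕ) (T : Finset 𝒟.Γ) (K : Set 𝒟.Γ) : Prop :=
  ∃ γ : 𝒟.Γ, ∀ x ∈ K, ∃ v ∈ 𝒟.VSet l n T, (x : G) = (𝒟.D l)^[n] γ * v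

/-- `(T, N)` is a testing tuple: every translate `x B(e, r)` of a ball of `Γ` is covered by a
set of the form `D^n(γ) V(n, T)` as soon as `n` is large (depending on `r` only), and `N` is the
smallest positive integer `m` such that all translates `x T` are covered by sets
`D^m(γ) V(m, T)`. -/
structure IsTestingTuple (l : ℝ) (T : Finset 𝒟.Γ) (N : ℕ) : Prop where
  domain : ∀ r : ℝ, 0 < r → ∃ N_r : ℕ, ∀ n : ℕ, N_r ≤ n → ∀ x : 𝒟.Γ,
    𝒟.Covered l n T {y | ∃ b : 𝒟.Γ, dist b 1 < r ∧ y = x * b}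
  isLeast : IsLeast {m : ℕ | 1 ≤ m ∧ ∀ x : 𝒟.Γ,
    𝒟.Covered l m T {y | ∃ b ∈ T, y = x * b}} N

end DilationDatum

/-! ## Substitutions -/

/-- A substitution datum `(A, l₀, S₀)` over a dilation datum; together they form a substitution
on `A^Γ`. -/
structure SubstitutionDatum {G : Type*} [Group G] [MetricSpace G] (𝒟 : DilationDatum G)
    (A : Type*) where
  finite_alphabet : Finite A
  /-- the stretch factor -/
  l₀ : ℝ
  isStretchFactor : 𝒟.IsStretchFactor l₀
  /-- the substitution rule `S₀ : A → A^(D_{l₀}[V] ∩ Γ)` -/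
  S₀ : A → {γ : 𝒟.Γ // (γ : G) ∈ 𝒟.D l₀ '' 𝒟.V} → A

namespace SubstitutionDatum

variable {G : Type*} [Group G] [MetricSpace G] {𝒟 : DilationDatum G} {A : Type*}
  (𝒮 : SubstitutionDatum 𝒟 A)

/-- The restriction `D : Γ → Γ` of `D_{l₀}`. -/
def DΓ (γ : 𝒟.Γ) : 𝒟.Γ := ⟨𝒟.D 𝒮.l₀ γ, 𝒮.isStretchFactor.map_mem γ γ.2⟩

/-- The unique `γ ∈ Γ` with `x ∈ D(γ) D[V]`, that is, with `D⁻¹(x) ∈ γ V`. -/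
def parent (x : 𝒟.Γ) : 𝒟.Γ := (𝒟.V_fundamental ((𝒟.D 𝒮.l₀).symm x)).choose

theorem parent_spec (x : 𝒟.Γ) :
    (((𝒮.DΓ (𝒮.parent x))⁻¹ * x : 𝒟.Γ) : G) ∈ 𝒟.D 𝒮.l₀ '' 𝒟.V := by
  refine ⟨_, (𝒟.V_fundamental ((𝒟.D 𝒮.l₀).symm x)).choose_spec.1, ?_⟩
  simp [DΓ, parent]

/-- The position of `x` inside the translate `D(γ) D[V]` containing it: `D(γ)⁻¹ x`. -/
def position (x : 𝒟.Γ) : {γ : 𝒟.Γ // (γ : G) ∈ 𝒟.D 𝒮.l₀ '' 𝒟.V} :=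
  ⟨(𝒮.DΓ (𝒮.parent x))⁻¹ * x, 𝒮.parent_spec x⟩

/-- The substitution map on patches: each letter `P γ` is replaced by the patch `S₀ (P γ)`
placed on `D(γ) D[V] ∩ Γ`. -/
def substPatch (P : Patch 𝒟.Γ A) : Patch 𝒟.Γ A :=
  fun x => (P (𝒮.parent x)).map fun a => 𝒮.S₀ a (𝒮.position x)

/-- The substitution map on configurations. -/
def substConfig (ω : Config 𝒟.Γ A) : Config 𝒟.Γ A :=
  fun x => 𝒮.S₀ (ω (𝒮.parent x)) (𝒮.position x)

theorem substPatch_ofConfig (ω : Config 𝒟.Γ A) :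
    𝒮.substPatch (Patch.ofConfig ω) = Patch.ofConfig (𝒮.substConfig ω) := rfl

/-- The set `W(S)` of legal patches: finite subpatches of `S^n(a)`, `n ≥ 1`, `a` a letter. -/
def legal : Set (Patch 𝒟.Γ A) :=
  {P | P.support.Finite ∧ ∃ n : ℕ, 1 ≤ n ∧ ∃ a : A,
    P.IsSubpatch (𝒮.substPatch^[n] (Patch.letter a))}

/-- The subshift `Ω(S)`. -/
def subshift : Set (Config 𝒟.Γ A) := {ω | dictionary ω ⊆ 𝒮.legal}

/-- Primitivity: for some `L ≥ 1`, every letter occurs in `S^L(b)` for every letter `b`. -/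
def IsPrimitive : Prop :=
  ∃ L : ℕ, 1 ≤ L ∧ ∀ a b : A,
    (Patch.letter a : Patch 𝒟.Γ A).IsSubpatch (𝒮.substPatch^[L] (Patch.letter b))

/-- The substitution graph `G_S(K; n)`. -/
def substGraph (K : Finset 𝒟.Γ) (n : ℕ) : Digraph (PatchOn A K) where
  Adj P Q := Q.1.IsSubpatch (𝒮.substPatch^[n] P.1) ∧ P.1 ∉ 𝒮.legal ∧ Q.1 ∉ 𝒮.legal

end SubstitutionDatum

/-- `(p 0, …, p m)` is a directed path of length `m` in the digraph. -/
def IsDirectedPath {𝒱 : Type*} (H : Digraph 𝒱) {m : ℕ} (p : Fin (m + 1) → 𝒱) : Prop :=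
  ∀ j : Fin m, H.Adj (p j.castSucc) (p j.succ)

/-- The path has a closed subpath `(p i, p (i + 1), …, p j)`, `i < j`, `p i = p j`. -/
def HasClosedSubpath {𝒱 : Type*} {m : ℕ} (p : Fin (m + 1) → 𝒱) : Prop :=
  ∃ i j : Fin (m + 1), i < j ∧ p i = p j

/-! ## Schrödinger operators -/

section Schroedinger

variable {G : Type*} [Group G] [MetricSpace G] {Γ : Subgroup G} {A : Type*}

/-- The Hilbert space `ℓ²(Γ)`. -/
abbrev L2 {G : Type*} [Group G] (Γ : Subgroup G) : Type _ := lp (fun _ : Γ => ℂ) 2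

/-- `H` is a Schrödinger operator with finite range: a family of bounded operators
`(H_ω ψ)(γ) = ∑_{η ∈ B} t_η(γ⁻¹ ω) ψ(γ η)` on `ℓ²(Γ)`, with `B = B⁻¹` finite and `t_η`
continuous, `t_η(ω)` being the complex conjugate of `t_{η⁻¹}(η⁻¹ ω)`, which says precisely that
all `H_ω` are self-adjoint. -/
def IsSchroedinger (H : Config Γ A → (L2 Γ →L[ℂ] L2 Γ)) : Prop :=
  ∃ (B : Finset Γ) (t : Γ → Config Γ A → ℂ),
    (∀ η ∈ B, η⁻¹ ∈ B) ∧
    (∀ η ∈ B, Continuous (t η)) ∧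
    (∀ η ∈ B, ∀ ω, t η ω = (starRingEnd ℂ) (t η⁻¹ (shift η⁻¹ ω))) ∧
    ∀ (ω : Config Γ A) (ψ : L2 Γ) (γ : Γ),
      (H ω ψ : Γ → ℂ) γ = ∑ η ∈ B, t η (shift γ⁻¹ ω) * (ψ : Γ → ℂ) (γ * η)

/-- The spectrum of a self-adjoint operator, as a subset of `ℝ`. -/
def realSpectrum (T : L2 Γ →L[ℂ] L2 Γ) : Set ℝ := {x | (x : ℂ) ∈ spectrum ℂ T}

end Schroedinger

/-! ## The convergence conditions -/

namespace SubstitutionDatum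

variable {G : Type*} [Group G] [MetricSpace G] {𝒟 : DilationDatum G} {A : Type*}
  (𝒮 : SubstitutionDatum 𝒟 A)

/-- For every Schrödinger operator `H` with finite range and every `ω ∈ Ω(S)`, the spectra of
`H_{S^n(ω₀)}` converge to the spectrum of `H_ω` in the Hausdorff metric. -/
def SpectralConvergence (ω₀ : Config 𝒟.Γ A) : Prop :=
  ∀ H : Config 𝒟.Γ A → (L2 𝒟.Γ →L[ℂ] L2 𝒟.Γ), IsSchroedinger H → ∀ ω ∈ 𝒮.subshift,
    Tendsto (fun n : ℕ => Metric.hausdorffDist (realSpectrum (H (𝒮.substConfig^[n] ω₀)))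
      (realSpectrum (H ω))) atTop (𝓝 0)

/-- The orbit closures of `S^n(ω₀)` converge to `Ω(S)` in the Hausdorff metric. -/
def SubshiftConvergence (ω₀ : Config 𝒟.Γ A) : Prop :=
  Tendsto (fun n : ℕ => Metric.hausdorffDist (orbitClosure (𝒮.substConfig^[n] ω₀)) 𝒮.subshift)
    atTop (𝓝 0)

/-- No directed path in `G_S(T; N)` starting in `W(ω₀)_T` contains a closed subpath. -/
def NoClosedSubpath (T : Finset 𝒟.Γ) (N : ℕ) (ω₀ : Config 𝒟.Γ A) : Prop :=
  ∀ (m : ℕ) (p : Fin (m + 1) → PatchOn A T), IsDirectedPath (𝒮.substGraph T N) p →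
    (p 0).1 ∈ dictionary ω₀ → ¬ HasClosedSubpath p

/-- All directed paths in `G_S(T; N)` starting in `W(ω₀)_T` have length less than `|A^T|`. -/
def ShortPaths (T : Finset 𝒟.Γ) (N : ℕ) (ω₀ : Config 𝒟.Γ A) : Prop :=
  ∀ (m : ℕ) (p : Fin (m + 1) → PatchOn A T), IsDirectedPath (𝒮.substGraph T N) p →
    (p 0).1 ∈ dictionary ω₀ → m < Nat.card (PatchOn A T)

/-- `ω₀` satisfies one of the four equivalent conditions for convergence; the last two refer to
a testing tuple, which may be any. -/
def IsConvergent (ω₀ : Config 𝒟.Γ A) : Prop :=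
  𝒮.SpectralConvergence ω₀ ∨ 𝒮.SubshiftConvergence ω₀ ∨
    (∃ (T : Finset 𝒟.Γ) (N : ℕ), 𝒟.IsTestingTuple 𝒮.l₀ T N ∧ 𝒮.NoClosedSubpath T N ω₀) ∨
    (∃ (T : Finset 𝒟.Γ) (N : ℕ), 𝒟.IsTestingTuple 𝒮.l₀ T N ∧ 𝒮.ShortPaths T N ω₀)

end SubstitutionDatum

end SymbolicSubstitution

end

/-! The parent map sends a lattice point `x` to the `γ` whose supertile `D(γ)D[V]` contains it. It
is `D⁻¹` up to a bounded error, so for a suitable `R` its `n`-th iterate maps sets of radius `R + l₀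
^ n` into sets of radius `R + 1` (`exists_dist_parent_iterate_lt`). Hence a patch of radius `l₀ ^ n`
in `S^n(ω)` is determined by a patch of `ω` on a translate of one fixed ball `T` of radius `R + 1`,
and this `T` covers itself after a single substitution step.

An illegal patch can only come from an illegal patch. If `S^{n₀}(ω₀)` with `n₀ = |A^T|` shows an
illegal patch on `T`, its ancestors form a path of length `n₀`, which must contain a cycle. Running
around the cycle makes one illegal patch occur in `S^n(ω₀)` for infinitely many `n`
(`legalOn_or_frequently_isSubpatch`). Each of the four conditions forbids this
(`IsConvergent.not_frequently_isSubpatch`), so after `n₀` steps, independently of `ω₀` and of the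
testing tuple it may come with, everything seen through `T` is legal. After `m` more steps all
patches of radius `l₀ ^ m` are legal.

Conversely, by primitivity there is one `k` such that the finitely many legal patches on `T` all
occur in `S^k(b)` for every letter `b`. Every legal patch of radius `l₀ ^ m` lies in `S^m(Q)` for
such a patch `Q`, hence occurs in `S^{n₀+k+m}(ω₀)`. The two inclusions of patches give the distance
bound (`hausdorffDist_le_of_legalOn`). -/

namespace SymbolicSubstitution

/-! ### Subpatches and windows -/

namespace Patch

variable {G : Type*} [Group G] {Γ : Subgroup G} {A : Type*}

theorem IsSubpatch.trans {P Q R : Patch Γ A} (h : P.IsSubpatch Q) (h' : Q.IsSubpatch R) :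
    P.IsSubpatch R := by
  obtain ⟨x, hx⟩ := h
  obtain ⟨y, hy⟩ := h'
  refine ⟨y * x, fun η hη => ?_⟩
  have hη' : x * η ∈ Q.support := by
    simp only [support, Set.mem_ofPred_eq, hx η hη]
    exact hη
  rw [mul_assoc, hy _ hη', hx η hη]

open Classical in
/-- The patch with support in `K` that is seen in `R` from `γ`. -/
noncomputable def window (R : Patch Γ A) (γ : Γ) (K : Set Γ) : Patch Γ A :=
  fun τ => if τ ∈ K then R (γ * τ) else none

theorem support_window_subset (R : Patch Γ A) (γ : Γ) (K : Set Γ) :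
    (window R γ K).support ⊆ K := by
  intro τ hτ
  by_contra h
  exact hτ (if_neg h)

theorem support_window_ofConfig (ω : Config Γ A) (γ : Γ) (K : Set Γ) :
    (window (ofConfig ω) γ K).support = K := by
  refine (support_window_subset _ _ _).antisymm fun τ hτ => ?_
  simp [support, window, hτ, ofConfig]

theorem window_of_mem (R : Patch Γ A) (γ : Γ) {K : Set Γ} {τ : Γ} (h : τ ∈ K) :
    window R γ K τ = R (γ * τ) := if_pos h

theorem window_isSubpatch (R : Patch Γ A) (γ : Γ) (K : Set Γ) :
    (window R γ K).IsSubpatch R :=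
  ⟨γ, fun _ hη => (window_of_mem R γ (support_window_subset _ _ _ hη)).symm⟩

theorem letter_isSubpatch {a : A} {Q : Patch Γ A} {x : Γ} (h : Q x = some a) :
    (letter a).IsSubpatch Q := by
  refine ⟨x, fun η hη => ?_⟩
  have : η = 1 := by
    by_contra h1
    exact hη (if_neg h1)
  subst this
  simp [letter, h]

theorem letter_isSubpatch_ofConfig (ω : Config Γ A) (x : Γ) :
    (letter (ω x)).IsSubpatch (ofConfig ω) :=
  letter_isSubpatch (x := x) rfl

theorem finite_setOf_support_subset [Finite A] {K : Set Γ} (hK : K.Finite) :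
    Finite {P : Patch Γ A // P.support ⊆ K} := by
  have := hK.to_subtype
  refine Finite.of_injective (β := K → Option A) (fun P k => P.1 k) ?_
  intro P Q h
  refine Subtype.ext (funext fun x => ?_)
  by_cases hx : x ∈ K
  · exact congrFun h ⟨x, hx⟩
  · have h1 : P.1 x = none := by
      by_contra h
      exact hx (P.2 h)
    have h2 : Q.1 x = none := by
      by_contra h
      exact hx (Q.2 h)
    rw [h1, h2]

end Patch

theorem finite_patchOn {G : Type*} [Group G] {Γ : Subgroup G} {A : Type*} [Finite A]
    (K : Finset Γ) : Finite (PatchOn A K) := by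
  have := Patch.finite_setOf_support_subset (A := A) K.finite_toSet
  exact Finite.of_injective (β := {P : Patch Γ A // P.support ⊆ (K : Set Γ)})
    (fun P => ⟨P.1, P.2.le⟩) fun P Q h => Subtype.ext (congrArg (fun X => X.1) h)

/-! ### The metric on configurations -/

section Configurations

variable {G : Type*} [Group G] [MetricSpace G] {Γ : Subgroup G} {A : Type*}

theorem dist_le_of_agreeOn {ω ρ : Config Γ A} {r : ℝ} (hr : 0 ≤ r) (h : AgreeOn r ω ρ) :
    dist ω ρ ≤ 1 / (r + 1) :=
  csInf_le (configDist_bddBelow ω ρ) ⟨r, hr, h, rfl⟩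

theorem agreeOn_of_dist_lt {ω ρ : Config Γ A} {r : ℝ} (hr : 0 ≤ r)
    (h : dist ω ρ < 1 / (r + 1)) : AgreeOn r ω ρ := by
  obtain ⟨s, hs, ha, hx⟩ := configDist_lt_iff.1 h
  have := (one_div_lt_one_div (by positivity) (by positivity)).1 hx
  exact fun γ hγ => ha γ (by linarith)

theorem config_dist_le_one (ω ρ : Config Γ A) : dist ω ρ ≤ 1 := by
  have := dist_le_of_agreeOn (ω := ω) (ρ := ρ) le_rfl
    (fun γ hγ => absurd hγ (not_lt.mpr dist_nonneg))
  simpa using this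

theorem config_isBounded (s : Set (Config Γ A)) : Bornology.IsBounded s :=
  Metric.isBounded_iff.2 ⟨1, fun x _ y _ => config_dist_le_one x y⟩

end Configurations

/-! ### Local finiteness of the lattice -/

namespace DilationDatum

variable {G : Type*} [Group G] [MetricSpace G] (𝒟 : DilationDatum G)

/-- A discrete subgroup is closed, so it meets the compact balls of a proper space in finite sets.
-/
theorem finite_ball (r : ℝ) : {γ : 𝒟.Γ | dist γ 1 < r}.Finite := by
  have := 𝒟.topologicalGroup
  have := 𝒟.proper
  have := 𝒟.discrete
  have hc : IsClosed (𝒟.Γ : Set G) := Subgroup.isClosed_of_discrete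
  have hK : IsCompact ((↑) ⁻¹' Metric.closedBall (1 : G) r : Set 𝒟.Γ) :=
    hc.isClosedEmbedding_subtypeVal.isCompact_preimage (isCompact_closedBall 1 r)
  exact hK.finite_of_discrete.subset fun γ (hγ : dist γ 1 < r) => hγ.le

theorem exists_bound_V : ∃ R : ℝ, 0 ≤ R ∧ ∀ v ∈ 𝒟.V, dist v 1 ≤ R := by
  obtain ⟨R, hR⟩ := (𝒟.V_relCompact.isBounded.subset subset_closure).subset_closedBall 1
  exact ⟨max R 0, le_max_right _ _, fun v hv => (hR hv).trans (le_max_left _ _)⟩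

theorem dist_mul_left (a x y : 𝒟.Γ) : dist (a * x) (a * y) = dist x y :=
  𝒟.left_invariant a x y

end DilationDatum

/-! ### Equivariance of the parent map -/

namespace SubstitutionDatum

open Patch

variable {G : Type*} [Group G] [MetricSpace G] {𝒟 : DilationDatum G} {A : Type*}
  (𝒮 : SubstitutionDatum 𝒟 A)

theorem l₀_pos : 0 < 𝒮.l₀ := one_pos.trans 𝒮.isStretchFactor.one_lt

theorem parent_mem (x : 𝒟.Γ) : (𝒮.parent x : G)⁻¹ * (𝒟.D 𝒮.l₀).symm x ∈ 𝒟.V :=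
  (𝒟.V_fundamental ((𝒟.D 𝒮.l₀).symm x)).choose_spec.1

theorem eq_parent {x γ : 𝒟.Γ} (h : (γ : G)⁻¹ * (𝒟.D 𝒮.l₀).symm x ∈ 𝒟.V) :
    γ = 𝒮.parent x :=
  (𝒟.V_fundamental ((𝒟.D 𝒮.l₀).symm x)).choose_spec.2 γ h

theorem parent_DΓ_mul (γ x : 𝒟.Γ) : 𝒮.parent (𝒮.DΓ γ * x) = γ * 𝒮.parent x := by
  refine (𝒮.eq_parent ?_).symm
  have h := 𝒮.parent_mem x
  simpa [DΓ, mul_assoc] using h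

theorem parent_one : 𝒮.parent 1 = 1 := by
  refine (𝒮.eq_parent ?_).symm
  simpa using interior_subset 𝒟.one_mem_interior_V

theorem parent_iterate_one (n : ℕ) : 𝒮.parent^[n] 1 = 1 :=
  Function.iterate_fixed 𝒮.parent_one n

theorem DΓ_mul (γ δ : 𝒟.Γ) : 𝒮.DΓ (γ * δ) = 𝒮.DΓ γ * 𝒮.DΓ δ :=
  Subtype.ext (map_mul (𝒟.D 𝒮.l₀) (γ : G) δ)

theorem DΓ_one : 𝒮.DΓ 1 = 1 := Subtype.ext (map_one (𝒟.D 𝒮.l₀))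

theorem DΓ_iterate_mul (n : ℕ) (γ δ : 𝒟.Γ) :
    𝒮.DΓ^[n] (γ * δ) = 𝒮.DΓ^[n] γ * 𝒮.DΓ^[n] δ := by
  induction n with
  | zero => rfl
  | succ n ih => simp only [Function.iterate_succ_apply', ih, DΓ_mul]

theorem DΓ_iterate_inv (n : ℕ) (γ : 𝒟.Γ) : 𝒮.DΓ^[n] γ⁻¹ = (𝒮.DΓ^[n] γ)⁻¹ := by
  rw [eq_inv_iff_mul_eq_one, ← DΓ_iterate_mul, inv_mul_cancel]
  exact Function.iterate_fixed 𝒮.DΓ_one n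

theorem coe_DΓ_iterate (n : ℕ) (γ : 𝒟.Γ) :
    ((𝒮.DΓ^[n] γ : 𝒟.Γ) : G) = (𝒟.D 𝒮.l₀)^[n] (γ : G) := by
  induction n with
  | zero => rfl
  | succ n ih => simp only [Function.iterate_succ_apply', ← ih]; rfl

theorem parent_iterate_DΓ_mul (n : ℕ) (γ x : 𝒟.Γ) :
    𝒮.parent^[n] (𝒮.DΓ^[n] γ * x) = γ * 𝒮.parent^[n] x := by
  induction n generalizing x with
  | zero => rfl
  | succ n ih =>
    rw [Function.iterate_succ_apply, Function.iterate_succ_apply', parent_DΓ_mul, ih,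
      Function.iterate_succ_apply]

theorem position_DΓ_mul (γ x : 𝒟.Γ) : 𝒮.position (𝒮.DΓ γ * x) = 𝒮.position x := by
  apply Subtype.ext
  simp only [position, parent_DΓ_mul, DΓ_mul]
  group

/-! ### The tiles `V(n, M)` in terms of the iterated parent map -/

theorem mem_tile_iff {M : Set 𝒟.Γ} {x : 𝒟.Γ} :
    (𝒟.D 𝒮.l₀).symm x ∈ 𝒟.tile M ↔ 𝒮.parent x ∈ M := by
  constructor
  · rintro ⟨γ, hγ, v, hv, h⟩
    rwa [← 𝒮.eq_parent (γ := γ) (by simpa [h] using hv)]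
  · intro h
    exact ⟨_, h, _, 𝒮.parent_mem x, by simp⟩

/-- Replaces the geometry of the iterated tiles by iteration of one map on `Γ`; all later covering
arguments use this form. The base case needs `e ∈ V`, so that the lattice points of `M · V` are
exactly those of `M`. -/
theorem mem_VSet_iff (n : ℕ) (M : Set 𝒟.Γ) (x : 𝒟.Γ) :
    (x : G) ∈ 𝒟.VSet 𝒮.l₀ n M ↔ 𝒮.parent^[n] x ∈ M := by
  induction n generalizing x with
  | zero =>
    constructor
    · rintro ⟨γ, hγ, v, hv, h⟩
      have : γ = x := (𝒟.V_fundamental (x : G)).unique (by simpa [h] using hv)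
        (by simpa using interior_subset 𝒟.one_mem_interior_V)
      simpa [← this] using hγ
    · intro h
      exact ⟨x, h, 1, interior_subset 𝒟.one_mem_interior_V, by simp⟩
  | succ n ih =>
    rw [Function.iterate_succ_apply, ← ih]
    change _ ∈ 𝒟.D 𝒮.l₀ '' _ ↔ _
    rw [show (𝒮.parent x : G) ∈ 𝒟.VSet 𝒮.l₀ n M ↔
      𝒮.parent x ∈ {γ : 𝒟.Γ | (γ : G) ∈ 𝒟.VSet 𝒮.l₀ n M} from Iff.rfl, ← 𝒮.mem_tile_iff]
    constructor
    · rintro ⟨g, hg, h⟩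
      rwa [← h, MulEquiv.symm_apply_apply]
    · intro h
      exact ⟨_, h, MulEquiv.apply_symm_apply _ _⟩

theorem covered_iff (n : ℕ) (T : Finset 𝒟.Γ) (K : Set 𝒟.Γ) :
    𝒟.Covered 𝒮.l₀ n T K ↔ ∃ γ : 𝒟.Γ, ∀ x ∈ K, γ⁻¹ * 𝒮.parent^[n] x ∈ T := by
  refine exists_congr fun γ => forall₂_congr fun x _ => ?_
  have key : 𝒮.parent^[n] ((𝒮.DΓ^[n] γ)⁻¹ * x) = γ⁻¹ * 𝒮.parent^[n] x := by
    rw [← DΓ_iterate_inv, parent_iterate_DΓ_mul]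
  rw [← key, ← Finset.mem_coe, ← mem_VSet_iff, ← coe_DΓ_iterate]
  constructor
  · rintro ⟨v, hv, h⟩
    have : (((𝒮.DΓ^[n] γ)⁻¹ * x : 𝒟.Γ) : G) = v := by
      simp [h]
    rwa [this]
  · intro h
    exact ⟨_, h, by simp⟩

/-! ### Contraction of the parent map -/

theorem dist_DΓ_iterate (n : ℕ) (g h : G) :
    dist ((𝒟.D 𝒮.l₀)^[n] g) ((𝒟.D 𝒮.l₀)^[n] h) = 𝒮.l₀ ^ n * dist g h := by
  induction n with
  | zero => simp
  | succ n ih =>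
    rw [Function.iterate_succ_apply', Function.iterate_succ_apply', 𝒟.D_dist _ 𝒮.l₀_pos, ih,
      pow_succ]
    ring

/-- Parents round `D⁻¹(x)` to a lattice point, with an error bounded by the size of `V`. -/
theorem exists_dist_parent_le : ∃ R : ℝ, 0 ≤ R ∧ ∀ x y : 𝒟.Γ,
    dist (𝒮.parent x) (𝒮.parent y) ≤ dist x y / 𝒮.l₀ + R := by
  obtain ⟨R, hR0, hR⟩ := 𝒟.exists_bound_V
  refine ⟨2 * R, by positivity, fun x y => ?_⟩
  have h1 : ∀ x : 𝒟.Γ, dist ((𝒟.D 𝒮.l₀).symm x) (𝒮.parent x : G) ≤ R := fun x => by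
    have := hR _ (𝒮.parent_mem x)
    rwa [← 𝒟.left_invariant (𝒮.parent x : G), mul_inv_cancel_left, mul_one] at this
  have h2 : dist ((𝒟.D 𝒮.l₀).symm x) ((𝒟.D 𝒮.l₀).symm y) = dist x y / 𝒮.l₀ := by
    rw [eq_div_iff 𝒮.l₀_pos.ne', mul_comm, ← 𝒟.D_dist _ 𝒮.l₀_pos]
    simp [Subtype.dist_eq]
  have h3 := dist_triangle4_left ((𝒟.D 𝒮.l₀).symm x) ((𝒟.D 𝒮.l₀).symm y) (𝒮.parent x : G)
    (𝒮.parent y)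
  have := h1 x
  have := h1 y
  rw [Subtype.dist_eq (𝒮.parent x)]
  linarith

theorem exists_dist_parent_iterate_lt : ∃ R : ℝ, 0 ≤ R ∧ ∀ (n : ℕ) (x y : 𝒟.Γ),
    dist x y < R + 𝒮.l₀ ^ n → dist (𝒮.parent^[n] x) (𝒮.parent^[n] y) < R + 1 := by
  obtain ⟨R, hR0, hR⟩ := 𝒮.exists_dist_parent_le
  have hl := 𝒮.isStretchFactor.one_lt
  have hl0 := 𝒮.l₀_pos
  have hl1 : 0 < 𝒮.l₀ - 1 := by linarith
  -- The fixed point of `t ↦ t / l₀ + R`: each step divides the excess over `R'` by `l₀`.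
  set R' := R * 𝒮.l₀ / (𝒮.l₀ - 1) with hR'
  have hfix : R' / 𝒮.l₀ + R = R' := by
    rw [hR']
    field_simp
    ring
  refine ⟨R', by positivity, fun n => ?_⟩
  induction n with
  | zero => intro x y h; simpa using h
  | succ n ih =>
    intro x y h
    refine ih _ _ ((hR x y).trans_lt ?_)
    have h1 : dist x y / 𝒮.l₀ < (R' + 𝒮.l₀ ^ (n + 1)) / 𝒮.l₀ :=
      div_lt_div_of_pos_right h hl0
    have h2 : (R' + 𝒮.l₀ ^ (n + 1)) / 𝒮.l₀ = R' / 𝒮.l₀ + 𝒮.l₀ ^ n := by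
      rw [pow_succ, add_div, mul_div_cancel_right₀ _ hl0.ne']
    linarith

/-! ### Locality of the substitution -/

/-- The value of `S^n(P)` at a point depends only on the letter at its `n`-th ancestor and on the
positions passed on the way, and positions do not change under translation by `D(γ)`. -/
theorem substPatch_iterate_apply_DΓ_mul (n : ℕ) (P Q : Patch 𝒟.Γ A) (γ x : 𝒟.Γ)
    (h : P (γ * 𝒮.parent^[n] x) = Q (𝒮.parent^[n] x)) :
    𝒮.substPatch^[n] P (𝒮.DΓ^[n] γ * x) = 𝒮.substPatch^[n] Q x := by
  induction n generalizing x with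
  | zero => exact h
  | succ n ih =>
    simp only [Function.iterate_succ_apply', substPatch, parent_DΓ_mul, position_DΓ_mul]
    rw [ih _ h]

theorem support_substPatch_iterate (n : ℕ) (P : Patch 𝒟.Γ A) :
    (𝒮.substPatch^[n] P).support = 𝒮.parent^[n] ⁻¹' P.support := by
  induction n with
  | zero => rfl
  | succ n ih =>
    ext x
    have : 𝒮.parent x ∈ (𝒮.substPatch^[n] P).support ↔ 𝒮.parent^[n + 1] x ∈ P.support := by
      rw [ih]; rfl
    rw [mem_preimage, ← this, Function.iterate_succ_apply']
    simp [support, substPatch]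

theorem substPatch_iterate_ofConfig (n : ℕ) (ω : Config 𝒟.Γ A) :
    𝒮.substPatch^[n] (ofConfig ω) = ofConfig (𝒮.substConfig^[n] ω) := by
  induction n with
  | zero => rfl
  | succ n ih => rw [Function.iterate_succ_apply', ih, Function.iterate_succ_apply']; rfl

theorem isSubpatch_substPatch_iterate {P Q : Patch 𝒟.Γ A} (h : P.IsSubpatch Q) (n : ℕ) :
    (𝒮.substPatch^[n] P).IsSubpatch (𝒮.substPatch^[n] Q) := by
  obtain ⟨γ, hγ⟩ := h
  refine ⟨𝒮.DΓ^[n] γ, fun η hη => 𝒮.substPatch_iterate_apply_DΓ_mul n Q P γ η (hγ _ ?_)⟩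
  rwa [support_substPatch_iterate] at hη

/-- The desubstitution step: a patch of `S^n(R)` survives if `R` is cut down to any window
containing the ancestors of its support. -/
theorem isSubpatch_substPatch_window {n : ℕ} {P R : Patch 𝒟.Γ A} {x γ : 𝒟.Γ} {K : Set 𝒟.Γ}
    (h : ∀ η ∈ P.support, 𝒮.substPatch^[n] R (x * η) = P η)
    (hK : ∀ η ∈ P.support, γ⁻¹ * 𝒮.parent^[n] (x * η) ∈ K) :
    P.IsSubpatch (𝒮.substPatch^[n] (window R γ K)) := by
  refine ⟨𝒮.DΓ^[n] γ⁻¹ * x, fun η hη => ?_⟩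
  rw [mul_assoc, ← h η hη]
  apply substPatch_iterate_apply_DΓ_mul
  rw [window_of_mem _ _ (hK η hη), mul_inv_cancel_left]

/-! ### Legal patches -/

theorem legal_of_isSubpatch_iterate {P Q : Patch 𝒟.Γ A} {n : ℕ} (hP : P.support.Finite)
    (h : P.IsSubpatch (𝒮.substPatch^[n] Q)) (hQ : Q ∈ 𝒮.legal) : P ∈ 𝒮.legal := by
  obtain ⟨-, k, hk, a, ha⟩ := hQ
  refine ⟨hP, n + k, by omega, a, h.trans ?_⟩
  rw [Function.iterate_add_apply]
  exact 𝒮.isSubpatch_substPatch_iterate ha n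

theorem exists_letter_isSubpatch_iterate (n : ℕ) (b : A) : ∃ a : A,
    (letter a : Patch 𝒟.Γ A).IsSubpatch (𝒮.substPatch^[n] (letter b)) := by
  have h : (1 : 𝒟.Γ) ∈ (𝒮.substPatch^[n] (letter b)).support := by
    rw [support_substPatch_iterate, mem_preimage, parent_iterate_one]
    simp [support, letter]
  obtain ⟨a, ha⟩ := Option.ne_none_iff_exists'.1 h
  exact ⟨a, letter_isSubpatch ha⟩

variable {𝒮} in
theorem IsPrimitive.exists_forall_isSubpatch (hprim : 𝒮.IsPrimitive) {P : Patch 𝒟.Γ A}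
    (hP : P ∈ 𝒮.legal) : ∃ k : ℕ, ∀ n, k ≤ n → ∀ b : A,
      P.IsSubpatch (𝒮.substPatch^[n] (letter b)) := by
  obtain ⟨L, -, hL⟩ := hprim
  obtain ⟨-, k, -, a, ha⟩ := hP
  -- Of `n = k + L + i` steps, the first `i` yield some letter `c`, the next `L` turn `c` into a
  -- patch containing `a`, and the last `k` produce `P`.
  refine ⟨k + L, fun n hn b => ?_⟩
  obtain ⟨i, rfl⟩ := Nat.exists_eq_add_of_le hn
  obtain ⟨c, hc⟩ := 𝒮.exists_letter_isSubpatch_iterate i b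
  rw [Function.iterate_add_apply, Function.iterate_add_apply]
  exact ha.trans (𝒮.isSubpatch_substPatch_iterate
    ((hL a c).trans (𝒮.isSubpatch_substPatch_iterate hc L)) k)

/-! ### The subshift -/

theorem shift_mem_subshift {ω : Config 𝒟.Γ A} (h : ω ∈ 𝒮.subshift) (x : 𝒟.Γ) :
    shift x ω ∈ 𝒮.subshift := by
  rintro P ⟨hP, y, hy⟩
  refine h ⟨hP, x⁻¹ * y, fun η hη => ?_⟩
  rw [← hy η hη, mul_assoc]
  rfl

theorem substConfig_iterate_mem_subshift {ω : Config 𝒟.Γ A} (h : ω ∈ 𝒮.subshift) (n : ℕ) :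
    𝒮.substConfig^[n] ω ∈ 𝒮.subshift := by
  rintro P ⟨hP, x, hx⟩
  rw [← substPatch_iterate_ofConfig] at hx
  have hfin : ((fun η => 𝒮.parent^[n] (x * η)) '' P.support).Finite := hP.image _
  refine 𝒮.legal_of_isSubpatch_iterate hP
    (𝒮.isSubpatch_substPatch_window (γ := 1) hx fun η hη => ?_)
    (h ⟨hfin.subset (support_window_subset _ _ _), window_isSubpatch _ _ _⟩)
  rw [inv_one, one_mul]
  exact mem_image_of_mem _ hη

/-- This is where the stretch factor must be sufficiently large: recentred at `D^n(z)`, the supports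
`V(s + n, {e})` contain balls of radius proportional to `l₀ ^ n` and so absorb every lattice point.
-/
theorem exists_eventually_mem_support : ∃ (s : ℕ) (z : 𝒟.Γ), ∀ γ : 𝒟.Γ, ∀ᶠ n : ℕ in atTop,
    𝒮.parent^[s + n] (𝒮.DΓ^[n] z * γ) = 1 := by
  obtain ⟨C, hC, s, z, h⟩ := 𝒮.isStretchFactor.sufficientlyLarge
  refine ⟨s, z, fun γ => ?_⟩
  have h1 : ∀ᶠ n : ℕ in atTop, dist γ 1 / C < 𝒮.l₀ ^ n :=
    (tendsto_pow_atTop_atTop_of_one_lt 𝒮.isStretchFactor.one_lt).eventually_gt_atTop _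
  filter_upwards [h1, eventually_ge_atTop 1] with n hn hn1
  have := h n hn1
  refine (𝒮.mem_VSet_iff (s + n) {1} _).1 (this ?_)
  have hsurj : Function.Surjective ((𝒟.D 𝒮.l₀)^[n]) := (𝒟.D 𝒮.l₀).surjective.iterate n
  obtain ⟨g, hg⟩ := hsurj ((𝒮.DΓ^[n] z * γ : 𝒟.Γ) : G)
  refine ⟨g, ?_, hg⟩
  have hpos : 0 < 𝒮.l₀ ^ n := pow_pos 𝒮.l₀_pos n
  have hd := 𝒮.dist_DΓ_iterate n g z
  rw [hg, ← coe_DΓ_iterate, ← Subtype.dist_eq] at hd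
  have hd' := 𝒟.dist_mul_left (𝒮.DΓ^[n] z) γ 1
  rw [mul_one, hd] at hd'
  rw [div_lt_iff₀ hC, ← hd'] at hn
  exact lt_of_mul_lt_mul_left hn hpos.le

/-- An ultralimit of the patches `S^{s+n}(a)` recentred at `D^n(z)`. Since the alphabet is finite,
each site has a letter that the ultrafilter selects, and any finite patch of the limit occurs in
some `S^{s+n}(a)`. -/
theorem subshift_nonempty (a : A) : 𝒮.subshift.Nonempty := by
  have := 𝒮.finite_alphabet
  obtain ⟨s, z, h⟩ := 𝒮.exists_eventually_mem_support
  have hU : (hyperfilter ℕ : Filter ℕ) ≤ atTop := by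
    rw [← Nat.cofinite_eq_atTop]; exact hyperfilter_le_cofinite
  have hex : ∀ γ : 𝒟.Γ, ∃ b : A, ∀ᶠ n in (hyperfilter ℕ : Filter ℕ),
      𝒮.substPatch^[s + n] (letter a) (𝒮.DΓ^[n] z * γ) = some b := by
    intro γ
    rw [← Ultrafilter.eventually_exists_iff]
    filter_upwards [hU (h γ)] with n hn
    refine Option.ne_none_iff_exists'.1 (?_ : _ ∈ (𝒮.substPatch^[s + n] (letter a)).support)
    rw [support_substPatch_iterate, mem_preimage, hn]
    simp [support, letter]
  choose ω hω using hex
  refine ⟨ω, ?_⟩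
  rintro P ⟨hP, x, hx⟩
  have hev : ∀ᶠ n in (hyperfilter ℕ : Filter ℕ), ∀ η ∈ P.support,
      𝒮.substPatch^[s + n] (letter a) (𝒮.DΓ^[n] z * (x * η)) = some (ω (x * η)) :=
    (eventually_all_finite hP).2 fun η _ => hω _
  obtain ⟨n, hn, hn1⟩ := (hev.and (hU (eventually_ge_atTop 1))).exists
  refine ⟨hP, s + n, by omega, a, 𝒮.DΓ^[n] z * x, fun η hη => ?_⟩
  rw [mul_assoc, hn η hη, ← hx η hη]
  rfl

variable {𝒮} in
theorem IsPrimitive.exists_mem_subshift (hprim : 𝒮.IsPrimitive) {P : Patch 𝒟.Γ A}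
    (hP : P ∈ 𝒮.legal) : ∃ ρ ∈ 𝒮.subshift, P.IsSubpatch (ofConfig ρ) := by
  obtain ⟨k, hk⟩ := hprim.exists_forall_isSubpatch hP
  obtain ⟨-, -, -, a, -⟩ := hP
  obtain ⟨ρ, hρ⟩ := 𝒮.subshift_nonempty a
  refine ⟨_, 𝒮.substConfig_iterate_mem_subshift hρ k, (hk k le_rfl (ρ 1)).trans ?_⟩
  rw [← substPatch_iterate_ofConfig]
  exact 𝒮.isSubpatch_substPatch_iterate (letter_isSubpatch_ofConfig ρ 1) k

end SubstitutionDatum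

/-! ## Diagonal Schrödinger operators -/

section PatchIndicator

open Patch

variable {G : Type*} [Group G] {Γ : Subgroup G} {A : Type*}

open Classical in
/-- The indicator function of the configurations that show the patch `P` at the identity. -/
noncomputable def patchIndicator (P : Patch Γ A) (ω : Config Γ A) : ℂ :=
  if ∀ η ∈ P.support, ofConfig ω η = P η then 1 else 0

theorem norm_patchIndicator_le (P : Patch Γ A) (ω : Config Γ A) : ‖patchIndicator P ω‖ ≤ 1 := by
  unfold patchIndicator
  split_ifs <;> simp

/-- Multiplication by the indicator function of the occurrences of the patch `P`. -/
noncomputable def occurrenceOperator (P : Patch Γ A) (ω : Config Γ A) : L2 Γ →L[ℂ] L2 Γ :=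
  lp.mapCLM 2 (fun γ : Γ => patchIndicator P (shift γ⁻¹ ω) • ContinuousLinearMap.id ℂ ℂ)
    (K := 1) zero_le_one fun γ => by
      refine (norm_smul_le _ _).trans ?_
      rw [ContinuousLinearMap.norm_id, mul_one]
      exact norm_patchIndicator_le _ _

theorem occurrenceOperator_apply (P : Patch Γ A) (ω : Config Γ A) (ψ : L2 Γ) (γ : Γ) :
    (occurrenceOperator P ω ψ : Γ → ℂ) γ = patchIndicator P (shift γ⁻¹ ω) * ψ γ := by
  simp [occurrenceOperator]

theorem isBounded_realSpectrum (T : L2 Γ →L[ℂ] L2 Γ) : Bornology.IsBounded (realSpectrum T) := by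
  obtain ⟨R, hR⟩ := (spectrum.isBounded (𝕜 := ℂ) T).subset_closedBall 0
  refine (Metric.isBounded_closedBall (x := (0 : ℝ)) (r := R)).subset fun x hx => ?_
  have := hR hx
  simpa using this

/-- The unit vector at a place where `P` occurs is an eigenvector for the eigenvalue `1`. -/
theorem one_mem_realSpectrum_occurrenceOperator {P : Patch Γ A} {ω : Config Γ A}
    (h : P.IsSubpatch (ofConfig ω)) : (1 : ℝ) ∈ realSpectrum (occurrenceOperator P ω) := by
  classical
  obtain ⟨x, hx⟩ := h
  have hker : (1 - occurrenceOperator P ω) (lp.single 2 x 1) = 0 := by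
    ext γ
    rw [sub_apply, one_apply_eq_self, lp.coeFn_sub, Pi.sub_apply,
      occurrenceOperator_apply, lp.single_apply]
    by_cases hγ : γ = x
    · subst hγ
      have : patchIndicator P (shift γ⁻¹ ω) = 1 := by
        refine if_pos fun η hη => ?_
        rw [← hx η hη]
        simp [ofConfig, shift]
      simp [this]
    · simp [hγ]
  change ((1 : ℝ) : ℂ) ∈ spectrum ℂ _
  rw [spectrum.mem_iff, Complex.ofReal_one, map_one]
  rintro ⟨u, hu⟩
  have h0 : (lp.single 2 x 1 : L2 Γ) = 0 := by
    have h1 : (↑u⁻¹ * ↑u : L2 Γ →L[ℂ] L2 Γ) (lp.single 2 x 1) = 0 := by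
      rw [hu, mul_apply_eq_comp, hker, map_zero]
    rwa [Units.inv_mul, one_apply_eq_self] at h1
  have := congrArg (fun ψ : L2 Γ => (ψ : Γ → ℂ) x) h0
  simp at this

theorem realSpectrum_occurrenceOperator_of_not_isSubpatch {P : Patch Γ A} {ω : Config Γ A}
    (h : ¬ P.IsSubpatch (ofConfig ω)) : realSpectrum (occurrenceOperator P ω) = {0} := by
  have h0 : occurrenceOperator P ω = 0 := by
    ext ψ γ
    rw [occurrenceOperator_apply]
    have : patchIndicator P (shift γ⁻¹ ω) = 0 := by
      refine if_neg fun hγ => h ⟨γ, fun η hη => ?_⟩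
      rw [← hγ η hη]
      simp [ofConfig, shift]
    simp [this]
  -- On the zero space the spectrum of `0` would be empty.
  have : Nontrivial (L2 Γ) := by
    classical
    refine ⟨lp.single 2 1 1, 0, fun h => ?_⟩
    have := congrArg (fun ψ : L2 Γ => (ψ : Γ → ℂ) 1) h
    simp at this
  ext x
  rw [h0, realSpectrum, mem_ofPred_eq, spectrum.zero_eq]
  simp

end PatchIndicator

section Schroedinger

open Patch

variable {G : Type*} [Group G] [MetricSpace G] {Γ : Subgroup G} {A : Type*}

theorem continuous_patchIndicator {P : Patch Γ A} (hP : P.support.Finite) :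
    Continuous (patchIndicator P) := by
  obtain ⟨r, hr0, hr⟩ : ∃ r : ℝ, 0 ≤ r ∧ ∀ η ∈ P.support, dist η 1 < r := by
    obtain ⟨r, hr⟩ := (hP.image fun η => dist η 1).bddAbove
    refine ⟨max r 0 + 1, by positivity, fun η hη => ?_⟩
    have := hr (mem_image_of_mem _ hη)
    have := le_max_left r 0
    linarith
  refine (IsLocallyConstant.iff_eventually_eq _).2 (fun ω => ?_) |>.continuous
  have hpos : 0 < 1 / (r + 1) := by positivity
  filter_upwards [Metric.ball_mem_nhds ω hpos] with ρ hρ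
  have hagree := agreeOn_of_dist_lt hr0 hρ
  have : (∀ η ∈ P.support, ofConfig ρ η = P η) ↔ ∀ η ∈ P.support, ofConfig ω η = P η :=
    forall₂_congr fun η hη => by rw [ofConfig, ofConfig, hagree η (hr η hη)]
  by_cases h : ∀ η ∈ P.support, ofConfig ω η = P η
  · exact (if_pos (this.2 h)).trans (if_pos h).symm
  · exact (if_neg (mt this.1 h)).trans (if_neg h).symm

theorem isSchroedinger_occurrenceOperator {P : Patch Γ A} (hP : P.support.Finite) :
    IsSchroedinger (occurrenceOperator P) := by
  refine ⟨{1}, fun _ => patchIndicator P, by simp, fun _ _ => continuous_patchIndicator hP, ?_, ?_⟩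
  · intro η hη ω
    obtain rfl : η = 1 := by simpa using hη
    have : shift (1 : Γ)⁻¹ ω = ω := by
      funext x
      simp [shift]
    change patchIndicator P ω = (starRingEnd ℂ) (patchIndicator P (shift (1 : Γ)⁻¹ ω))
    rw [this, patchIndicator]
    split_ifs <;> simp
  · intro ω ψ γ
    simp [occurrenceOperator_apply]

end Schroedinger

/-! ### Propagation of legality -/

namespace SubstitutionDatum

open Patch

variable {G : Type*} [Group G] [MetricSpace G] {𝒟 : DilationDatum G} {A : Type*}
  (𝒮 : SubstitutionDatum 𝒟 A)

/-- All patches of `ω` on translates of `K` are legal. -/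
def LegalOn (ω : Config 𝒟.Γ A) (K : Set 𝒟.Γ) : Prop :=
  ∀ x : 𝒟.Γ, window (ofConfig ω) x K ∈ 𝒮.legal

variable {𝒮}

theorem LegalOn.legal_of_isSubpatch {ω : Config 𝒟.Γ A} {K : Set 𝒟.Γ} (h : 𝒮.LegalOn ω K)
    {n : ℕ} {L : Set 𝒟.Γ} (hcov : ∀ x, ∃ γ : 𝒟.Γ, ∀ y ∈ L, γ⁻¹ * 𝒮.parent^[n] (x * y) ∈ K)
    {P : Patch 𝒟.Γ A} (hfin : P.support.Finite) (hL : P.support ⊆ L)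
    (hP : P.IsSubpatch (ofConfig (𝒮.substConfig^[n] ω))) : P ∈ 𝒮.legal := by
  obtain ⟨x, hx⟩ := hP
  obtain ⟨γ, hγ⟩ := hcov x
  rw [← substPatch_iterate_ofConfig] at hx
  exact 𝒮.legal_of_isSubpatch_iterate hfin
    (𝒮.isSubpatch_substPatch_window hx fun η hη => hγ η (hL hη)) (h γ)

theorem LegalOn.substConfig_iterate {ω : Config 𝒟.Γ A} {K : Set 𝒟.Γ} (h : 𝒮.LegalOn ω K)
    {n : ℕ} {L : Set 𝒟.Γ} (hcov : ∀ x, ∃ γ : 𝒟.Γ, ∀ y ∈ L, γ⁻¹ * 𝒮.parent^[n] (x * y) ∈ K)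
    (hL : L.Finite) : 𝒮.LegalOn (𝒮.substConfig^[n] ω) L := fun _ =>
  h.legal_of_isSubpatch hcov (hL.subset (support_window_subset _ _ _))
    (support_window_subset _ _ _) (window_isSubpatch _ _ _)

/-! ### Paths in the substitution graph -/

/-- The path is built backwards: since `T` covers its translates after `N` steps, each patch on `T`
comes from a patch on `T` that lives `N` steps earlier, and that one is illegal because legality is
inherited by descendants. -/
theorem exists_path {T : Finset 𝒟.Γ} {N : ℕ}
    (hcov : ∀ x, ∃ γ : 𝒟.Γ, ∀ y ∈ T, γ⁻¹ * 𝒮.parent^[N] (x * y) ∈ T) (ω₀ : Config 𝒟.Γ A)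
    (k : ℕ) {Q : PatchOn A T} (hQ : Q.1 ∉ 𝒮.legal)
    (hsub : Q.1.IsSubpatch (ofConfig (𝒮.substConfig^[N * k] ω₀))) :
    ∃ q : ℕ → PatchOn A T, (∀ j < k, (𝒮.substGraph T N).Adj (q j) (q (j + 1))) ∧
      (q 0).1 ∈ dictionary ω₀ ∧ q k = Q := by
  induction k generalizing Q with
  | zero =>
    refine ⟨fun _ => Q, by simp, ⟨?_, hsub⟩, rfl⟩
    rw [Q.2]
    exact T.finite_toSet
  | succ k ih =>
    have hfin : Q.1.support.Finite := by
      rw [Q.2]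
      exact T.finite_toSet
    obtain ⟨x, hx⟩ := hsub
    obtain ⟨γ, hγ⟩ := hcov x
    rw [Nat.mul_succ, Nat.add_comm, Function.iterate_add_apply,
      ← substPatch_iterate_ofConfig] at hx
    have hPQ : Q.1.IsSubpatch (𝒮.substPatch^[N]
        (window (ofConfig (𝒮.substConfig^[N * k] ω₀)) γ T)) :=
      𝒮.isSubpatch_substPatch_window hx fun η hη => hγ η (by rwa [Q.2] at hη)
    have hP : window (ofConfig (𝒮.substConfig^[N * k] ω₀)) γ T ∉ 𝒮.legal := fun h =>
      hQ (𝒮.legal_of_isSubpatch_iterate hfin hPQ h)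
    obtain ⟨q, hq, hq0, hqk⟩ := ih (Q := ⟨_, support_window_ofConfig _ γ (T : Set 𝒟.Γ)⟩) hP
      (window_isSubpatch _ _ _)
    refine ⟨fun j => if j ≤ k then q j else Q, fun j hj => ?_, by simpa using hq0, by simp⟩
    rcases Nat.lt_succ_iff_lt_or_eq.1 hj with hj | rfl
    · simpa [hj.le, Nat.succ_le_iff.2 hj] using hq j hj
    · simp only [le_refl, if_true, Nat.not_succ_le_self, if_false, hqk]
      exact ⟨hPQ, hP, hQ⟩

theorem exists_map_eq {T : Finset 𝒟.Γ} [Finite A] {k : ℕ} (hk : Nat.card (PatchOn A T) ≤ k)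
    (q : ℕ → PatchOn A T) : ∃ i j, i < j ∧ j ≤ k ∧ q i = q j := by
  have := finite_patchOn (A := A) T
  have := Fintype.ofFinite (PatchOn A T)
  obtain ⟨i, j, hij, h⟩ := Fintype.exists_ne_map_eq_of_card_lt (fun i : Fin (k + 1) => q i) (by
    rw [← Nat.card_eq_fintype_card, Fintype.card_fin]
    omega)
  rcases lt_or_gt_of_ne hij with hij | hij
  · exact ⟨i, j, hij, by omega, h⟩
  · exact ⟨j, i, hij, by omega, h.symm⟩

theorem isSubpatch_of_path {T : Finset 𝒟.Γ} {k : ℕ} {q : ℕ → PatchOn A T}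
    (hq : ∀ j < k, (𝒮.substGraph T 1).Adj (q j) (q (j + 1))) {i : ℕ} (m : ℕ) (hm : i + m ≤ k) :
    (q (i + m)).1.IsSubpatch (𝒮.substPatch^[m] (q i).1) := by
  induction m with
  | zero => exact ⟨1, fun η _ => by simp⟩
  | succ m ih =>
    rw [Function.iterate_succ_apply']
    exact (hq (i + m) (by omega)).1.trans
      (𝒮.isSubpatch_substPatch_iterate (ih (by omega)) 1)

/-- An illegal patch that survives long enough survives forever. -/
theorem legalOn_or_frequently_isSubpatch [Finite A] {T : Finset 𝒟.Γ}
    (hcov : ∀ x, ∃ γ : 𝒟.Γ, ∀ y ∈ T, γ⁻¹ * 𝒮.parent^[1] (x * y) ∈ T) (ω₀ : Config 𝒟.Γ A) :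
    𝒮.LegalOn (𝒮.substConfig^[Nat.card (PatchOn A T)] ω₀) T ∨
      ∃ P : Patch 𝒟.Γ A, P.support.Finite ∧ P ∉ 𝒮.legal ∧
        ∃ᶠ n in atTop, P.IsSubpatch (ofConfig (𝒮.substConfig^[n] ω₀)) := by
  refine or_iff_not_imp_left.2 fun h => ?_
  simp only [LegalOn, not_forall] at h
  obtain ⟨x, hx⟩ := h
  obtain ⟨q, hq, hq0, -⟩ := exists_path hcov ω₀ (Nat.card (PatchOn A T))
    (Q := ⟨_, support_window_ofConfig _ x (T : Set 𝒟.Γ)⟩) hx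
    (by rw [one_mul]; exact window_isSubpatch _ _ _)
  obtain ⟨i, j, hij, hj, heq⟩ := exists_map_eq le_rfl q
  obtain ⟨c, rfl⟩ := Nat.exists_eq_add_of_lt hij
  refine ⟨(q i).1, ?_, (hq i (by omega)).2.1, ?_⟩
  · rw [(q i).2]
    exact T.finite_toSet
  have hstep := isSubpatch_of_path hq (i := i) (c + 1) hj
  rw [← add_assoc, ← heq] at hstep
  have h0 : (q i).1.IsSubpatch (ofConfig (𝒮.substConfig^[i] ω₀)) := by
    have := isSubpatch_of_path hq (i := 0) i (by omega)
    rw [zero_add] at this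
    rw [← substPatch_iterate_ofConfig]
    exact this.trans (𝒮.isSubpatch_substPatch_iterate hq0.2 i)
  -- The patch reproduces itself in `c + 1` steps, so it recurs along an arithmetic progression.
  have hall : ∀ t, (q i).1.IsSubpatch (ofConfig (𝒮.substConfig^[(c + 1) * t + i] ω₀)) := by
    intro t
    induction t with
    | zero => simpa using h0
    | succ t ih =>
      rw [show (c + 1) * (t + 1) + i = (c + 1) + ((c + 1) * t + i) by ring,
        Function.iterate_add_apply, ← substPatch_iterate_ofConfig]
      exact hstep.trans (𝒮.isSubpatch_substPatch_iterate ih (c + 1))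
  refine frequently_atTop.2 fun t => ⟨_, ?_, hall t⟩
  nlinarith [Nat.zero_le (c * t)]

/-! ### The convergence conditions exclude persistent illegal patches -/

variable {ω₀ : Config 𝒟.Γ A} {P : Patch 𝒟.Γ A}

/-- The test operator is multiplication by the occurrences of `P`: its spectrum is `{0}` on the
subshift and contains `1` whenever `P` occurs, so the spectra cannot converge. -/
theorem SpectralConvergence.not_frequently_isSubpatch (h : 𝒮.SpectralConvergence ω₀)
    (hfin : P.support.Finite) (hP : P ∉ 𝒮.legal) :
    ¬ ∃ᶠ n in atTop, P.IsSubpatch (ofConfig (𝒮.substConfig^[n] ω₀)) := by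
  intro hfreq
  obtain ⟨ω, hω⟩ := 𝒮.subshift_nonempty (ω₀ 1)
  have hlim := h _ (isSchroedinger_occurrenceOperator hfin) ω hω
  rw [realSpectrum_occurrenceOperator_of_not_isSubpatch fun hs => hP (hω ⟨hfin, hs⟩)] at hlim
  obtain ⟨n, hn, hlt⟩ := (hfreq.and_eventually (hlim.eventually_lt_const one_pos)).exists
  have hmem := one_mem_realSpectrum_occurrenceOperator hn
  obtain ⟨y, hy, hdist⟩ := Metric.exists_dist_lt_of_hausdorffDist_lt hmem hlt
    -- `Metric.hausdorffDist` takes the default value `0` at infinite distance, which has to be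
    -- excluded.
    (Metric.hausdorffEDist_ne_top_of_nonempty_of_bounded ⟨_, hmem⟩ (singleton_nonempty _)
      (isBounded_realSpectrum _) Bornology.isBounded_singleton)
  rw [mem_singleton_iff.1 hy] at hdist
  simp at hdist

theorem SubshiftConvergence.not_frequently_isSubpatch (h : 𝒮.SubshiftConvergence ω₀)
    (hfin : P.support.Finite) (hP : P ∉ 𝒮.legal) :
    ¬ ∃ᶠ n in atTop, P.IsSubpatch (ofConfig (𝒮.substConfig^[n] ω₀)) := by
  intro hfreq
  obtain ⟨r, hr⟩ := (hfin.image fun η => dist η 1).bddAbove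
  have hpos : 0 < 1 / ((max r 0 + 1) + 1) := by positivity
  obtain ⟨n, ⟨x, hx⟩, hlt⟩ := (hfreq.and_eventually (h.eventually_lt_const hpos)).exists
  -- The occurrence of `P` is moved to the identity, where closeness in the metric forces agreement.
  have hmem : shift x⁻¹ (𝒮.substConfig^[n] ω₀) ∈ orbitClosure (𝒮.substConfig^[n] ω₀) :=
    subset_closure ⟨x⁻¹, rfl⟩
  obtain ⟨ρ, hρ, hdist⟩ := Metric.exists_dist_lt_of_hausdorffDist_lt hmem hlt
    (Metric.hausdorffEDist_ne_top_of_nonempty_of_bounded ⟨_, hmem⟩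
      (𝒮.subshift_nonempty (ω₀ 1)) (config_isBounded _) (config_isBounded _))
  have hagree := agreeOn_of_dist_lt (by positivity) hdist
  refine hP (hρ ⟨hfin, 1, fun η hη => ?_⟩)
  have h1 : dist η 1 ≤ r := hr (mem_image_of_mem _ hη)
  have h2 := hagree η (by linarith [le_max_left r 0])
  rw [← hx η hη, one_mul, ofConfig, ofConfig, ← h2]
  simp [shift]

theorem NoClosedSubpath.shortPaths [Finite A] {T : Finset 𝒟.Γ} {N : ℕ}
    (h : 𝒮.NoClosedSubpath T N ω₀) : 𝒮.ShortPaths T N ω₀ := by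
  intro m p hp hp0
  by_contra hm
  obtain ⟨i, j, hij, hj, heq⟩ := exists_map_eq (not_lt.1 hm)
    -- The wrap-around of `Fin.ofNat` plays no role, since both indices are at most `m`.
    (fun i : ℕ => p (Fin.ofNat (m + 1) i))
  refine h m p hp hp0 ⟨_, _, ?_, heq⟩
  rw [Fin.lt_def, Fin.val_ofNat, Fin.val_ofNat, Nat.mod_eq_of_lt (by omega),
    Nat.mod_eq_of_lt (by omega)]
  exact hij

/-- Paths of length `|A^T|` being excluded, all patches on `T` are legal after `N * |A^T|` steps.
The first property of a testing tuple then carries legality to the support of `P` for all later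
times. -/
theorem ShortPaths.not_frequently_isSubpatch {T : Finset 𝒟.Γ} {N : ℕ}
    (hT : 𝒟.IsTestingTuple 𝒮.l₀ T N) (h : 𝒮.ShortPaths T N ω₀)
    (hfin : P.support.Finite) (hP : P ∉ 𝒮.legal) :
    ¬ ∃ᶠ n in atTop, P.IsSubpatch (ofConfig (𝒮.substConfig^[n] ω₀)) := by
  intro hfreq
  have hcov : ∀ x, ∃ γ : 𝒟.Γ, ∀ y ∈ T, γ⁻¹ * 𝒮.parent^[N] (x * y) ∈ T := fun x => by
    obtain ⟨γ, hγ⟩ := (𝒮.covered_iff _ _ _).1 (hT.isLeast.1.2 x)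
    exact ⟨γ, fun y hy => hγ _ ⟨y, hy, rfl⟩⟩
  have hlegal : 𝒮.LegalOn (𝒮.substConfig^[N * Nat.card (PatchOn A T)] ω₀) T := by
    intro x
    by_contra hx
    obtain ⟨q, hq, hq0, -⟩ := exists_path hcov ω₀ (Nat.card (PatchOn A T))
      (Q := ⟨_, support_window_ofConfig _ x (T : Set 𝒟.Γ)⟩) hx (window_isSubpatch _ _ _)
    exact lt_irrefl _ (h _ (fun i => q i) (fun j => hq j j.2) hq0)
  obtain ⟨r, hr⟩ := (hfin.image fun η => dist η 1).bddAbove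
  obtain ⟨N_r, hN⟩ := hT.domain (max r 0 + 1) (by positivity)
  obtain ⟨n, hn, hsub⟩ :=
    frequently_atTop.1 hfreq (N_r + N * Nat.card (PatchOn A T))
  obtain ⟨m, rfl⟩ := Nat.exists_eq_add_of_le hn
  rw [show N_r + N * Nat.card (PatchOn A T) + m = (N_r + m) + N * Nat.card (PatchOn A T) by ring,
    Function.iterate_add_apply] at hsub
  refine hP (hlegal.legal_of_isSubpatch (n := N_r + m) (L := P.support) (fun x => ?_) hfin
    Subset.rfl hsub)
  obtain ⟨γ, hγ⟩ := (𝒮.covered_iff _ _ _).1 (hN (N_r + m) (by omega) x)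
  refine ⟨γ, fun y hy => hγ _ ⟨y, ?_, rfl⟩⟩
  have h1 : dist y 1 ≤ r := hr (mem_image_of_mem _ hy)
  linarith [le_max_left r 0]

theorem IsConvergent.not_frequently_isSubpatch (h : 𝒮.IsConvergent ω₀)
    (hfin : P.support.Finite) (hP : P ∉ 𝒮.legal) :
    ¬ ∃ᶠ n in atTop, P.IsSubpatch (ofConfig (𝒮.substConfig^[n] ω₀)) := by
  have := 𝒮.finite_alphabet
  rcases h with h | h | ⟨T, N, hT, h⟩ | ⟨T, N, hT, h⟩
  · exact h.not_frequently_isSubpatch hfin hP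
  · exact h.not_frequently_isSubpatch hfin hP
  · exact h.shortPaths.not_frequently_isSubpatch hT hfin hP
  · exact h.not_frequently_isSubpatch hT hfin hP

/-! ### Uniform rates -/

theorem hausdorffDist_le_of_legalOn (hprim : 𝒮.IsPrimitive) {ω : Config 𝒟.Γ A} {r : ℝ}
    (hr : 0 ≤ r) (h : 𝒮.LegalOn ω {γ | dist γ 1 < r})
    (h' : ∀ P ∈ 𝒮.legal, P.support ⊆ {γ | dist γ 1 < r} → P.IsSubpatch (ofConfig ω)) :
    Metric.hausdorffDist (orbitClosure ω) 𝒮.subshift ≤ 1 / (r + 1) := by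
  -- Hausdorff distance ignores closures, so it suffices to match points of the orbit itself.
  rw [orbitClosure, Metric.hausdorffDist_closure₁]
  refine Metric.hausdorffDist_le_of_mem_dist (by positivity) ?_ ?_
  · rintro _ ⟨x, rfl⟩
    obtain ⟨ρ, hρ, y, hy⟩ := hprim.exists_mem_subshift (h x⁻¹)
    refine ⟨shift y⁻¹ ρ, 𝒮.shift_mem_subshift hρ _, dist_le_of_agreeOn hr fun γ hγ => ?_⟩
    have := hy γ (by rwa [support_window_ofConfig])
    rw [window_of_mem _ _ (by exact hγ)] at this
    simpa [shift, ofConfig] using this.symm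
  · intro ρ hρ
    obtain ⟨y, hy⟩ := h' (window (ofConfig ρ) 1 {γ | dist γ 1 < r})
      (hρ ⟨(𝒟.finite_ball r).subset (support_window_subset _ _ _), window_isSubpatch _ _ _⟩)
      (support_window_subset _ _ _)
    refine ⟨_, ⟨y⁻¹, rfl⟩, dist_le_of_agreeOn hr fun γ hγ => ?_⟩
    have := hy γ (by rwa [support_window_ofConfig])
    rw [window_of_mem _ _ (by exact hγ)] at this
    simpa [shift, ofConfig] using this.symm

theorem IsPrimitive.exists_uniform_isSubpatch (hprim : 𝒮.IsPrimitive) {T : Set 𝒟.Γ}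
    (hT : T.Finite) : ∃ k : ℕ, ∀ Q ∈ 𝒮.legal, Q.support ⊆ T → ∀ b : A,
      Q.IsSubpatch (𝒮.substPatch^[k] (letter b)) := by
  have := 𝒮.finite_alphabet
  have := finite_setOf_support_subset (A := A) hT
  have hex : ∀ Q : {Q : Patch 𝒟.Γ A // Q.support ⊆ T}, ∃ k : ℕ, Q.1 ∈ 𝒮.legal → ∀ n, k ≤ n →
      ∀ b : A, Q.1.IsSubpatch (𝒮.substPatch^[n] (letter b)) := fun Q => by
    by_cases hQ : Q.1 ∈ 𝒮.legal
    · obtain ⟨k, hk⟩ := hprim.exists_forall_isSubpatch hQ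
      exact ⟨k, fun _ => hk⟩
    · exact ⟨0, fun h => absurd h hQ⟩
  choose f hf using hex
  obtain ⟨k, hk⟩ := Finite.exists_le f
  exact ⟨k, fun Q hQ hQT => hf ⟨Q, hQT⟩ hQ k (hk _)⟩

/-- By primitivity `P` occurs in `S^j(a)` for all large `j`, in particular for some `j > n`;
desubstituting `n` times leaves a window of `S^{j-n}(a)`, which is legal. -/
theorem exists_isSubpatch_of_legal (hprim : 𝒮.IsPrimitive) {T L : Set 𝒟.Γ} (hT : T.Finite)
    {n : ℕ} (hcov : ∀ x, ∃ γ : 𝒟.Γ, ∀ y ∈ L, γ⁻¹ * 𝒮.parent^[n] (x * y) ∈ T)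
    (hP : P ∈ 𝒮.legal) (hPL : P.support ⊆ L) : ∃ Q ∈ 𝒮.legal, Q.support ⊆ T ∧
      P.IsSubpatch (𝒮.substPatch^[n] Q) := by
  obtain ⟨k, hk⟩ := hprim.exists_forall_isSubpatch hP
  have ha := hP.2
  obtain ⟨-, -, a, -⟩ := ha
  -- `k + 1` rather than `k`, as legality demands at least one substitution step.
  obtain ⟨x, hx⟩ := hk (n + (k + 1)) (by omega) a
  obtain ⟨γ, hγ⟩ := hcov x
  rw [Function.iterate_add_apply] at hx
  exact ⟨_, ⟨hT.subset (support_window_subset _ _ _), k + 1, by omega, a,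
    window_isSubpatch _ _ _⟩, support_window_subset _ _ _,
    𝒮.isSubpatch_substPatch_window hx fun η hη => hγ η (hPL hη)⟩

variable (𝒮) in
/-- The orbit closures of convergent initial configurations converge at the uniform rate
`l₀⁻ⁿ`. -/
theorem exists_hausdorffDist_le (hprim : 𝒮.IsPrimitive) :
    ∃ C : ℝ, 0 < C ∧ ∃ M₁ : ℝ, 0 ≤ M₁ ∧ ∀ ω₀ : Config 𝒟.Γ A, 𝒮.IsConvergent ω₀ →
      ∀ n : ℕ, M₁ ≤ (n : ℝ) →
        Metric.hausdorffDist (orbitClosure (𝒮.substConfig^[n] ω₀)) 𝒮.subshift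
          ≤ C / 𝒮.l₀ ^ n := by
  have := 𝒮.finite_alphabet
  obtain ⟨R, hR0, hR⟩ := 𝒮.exists_dist_parent_iterate_lt
  set T : Finset 𝒟.Γ := (𝒟.finite_ball (R + 1)).toFinset with hT
  have hmemT : ∀ γ : 𝒟.Γ, γ ∈ T ↔ dist γ 1 < R + 1 := fun γ => by simp [hT]
  have hcov : ∀ (m : ℕ) (x : 𝒟.Γ), ∃ γ : 𝒟.Γ, ∀ y : 𝒟.Γ, dist y 1 < R + 𝒮.l₀ ^ m →
      γ⁻¹ * 𝒮.parent^[m] (x * y) ∈ T := by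
    refine fun m x => ⟨𝒮.parent^[m] x, fun y hy => ?_⟩
    rw [hmemT, ← 𝒟.dist_mul_left (𝒮.parent^[m] x), mul_inv_cancel_left, mul_one]
    apply hR
    have := 𝒟.dist_mul_left x y 1
    rw [mul_one] at this
    rwa [this]
  -- `T` covers itself after one step because `R + 1 < R + l₀`.
  have hcov1 : ∀ x, ∃ γ : 𝒟.Γ, ∀ y ∈ T, γ⁻¹ * 𝒮.parent^[1] (x * y) ∈ T := fun x => by
    obtain ⟨γ, hγ⟩ := hcov 1 x
    refine ⟨γ, fun y hy => hγ y ?_⟩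
    have := (hmemT y).1 hy
    have := 𝒮.isStretchFactor.one_lt
    rw [pow_one]
    linarith
  have hcovball : ∀ (m : ℕ) (x : 𝒟.Γ), ∃ γ : 𝒟.Γ, ∀ y ∈ {y : 𝒟.Γ | dist y 1 < 𝒮.l₀ ^ m},
      γ⁻¹ * 𝒮.parent^[m] (x * y) ∈ (T : Set 𝒟.Γ) := fun m x => by
    obtain ⟨γ, hγ⟩ := hcov m x
    exact ⟨γ, fun y (hy : dist y 1 < _) => hγ y (by linarith)⟩
  obtain ⟨k, hk⟩ := hprim.exists_uniform_isSubpatch T.finite_toSet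
  set n₀ := Nat.card (SymbolicSubstitution.PatchOn A T)
  have hl := 𝒮.l₀_pos
  -- Patches of radius `l₀ ^ m` are controlled at time `n = n₀ + k + m`, and `1 / l₀ ^ m = l₀ ^ (n₀
  -- + k) / l₀ ^ n`.
  refine ⟨𝒮.l₀ ^ (n₀ + k), by positivity, ((n₀ + k : ℕ) : ℝ), Nat.cast_nonneg _,
    fun ω₀ hω₀ n hn => ?_⟩
  obtain ⟨m, rfl⟩ := Nat.exists_eq_add_of_le (Nat.cast_le.1 hn)
  have hpow : 0 < 𝒮.l₀ ^ m := pow_pos hl m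
  have hlegal : 𝒮.LegalOn (𝒮.substConfig^[n₀] ω₀) (T : Set 𝒟.Γ) := by
    refine (legalOn_or_frequently_isSubpatch hcov1 ω₀).resolve_right ?_
    rintro ⟨P, hfin, hP, hfreq⟩
    exact hω₀.not_frequently_isSubpatch hfin hP hfreq
  have hball : {γ : 𝒟.Γ | dist γ 1 < 𝒮.l₀ ^ m} ⊆ {γ | dist γ 1 < 𝒮.l₀ ^ (m + k)} :=
    fun γ (hγ : dist γ 1 < _) => hγ.trans_le
      (pow_le_pow_right₀ 𝒮.isStretchFactor.one_lt.le (Nat.le_add_right m k))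
  refine (hausdorffDist_le_of_legalOn hprim hpow.le ?_ ?_).trans ?_
  · rw [show n₀ + k + m = (m + k) + n₀ by ring, Function.iterate_add_apply]
    refine hlegal.substConfig_iterate (fun x => ?_) (𝒟.finite_ball _)
    obtain ⟨γ, hγ⟩ := hcovball (m + k) x
    exact ⟨γ, fun y hy => hγ y (hball hy)⟩
  · intro P hP hPL
    obtain ⟨Q, hQ, hQT, hPQ⟩ :=
      exists_isSubpatch_of_legal hprim T.finite_toSet (hcovball m) hP hPL
    rw [show n₀ + k + m = m + (k + n₀) by ring, Function.iterate_add_apply,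
      Function.iterate_add_apply, ← substPatch_iterate_ofConfig, ← substPatch_iterate_ofConfig]
    -- The letter of `S^{n₀}(ω₀)` at the identity, whichever it is, generates `Q` in `k` steps and
    -- then `P` in `m` more.
    refine hPQ.trans (𝒮.isSubpatch_substPatch_iterate ((hk Q hQ hQT _).trans
      (𝒮.isSubpatch_substPatch_iterate (letter_isSubpatch_ofConfig _ 1) k)) m)
  · rw [pow_add _ (n₀ + k), ← div_div, div_self (pow_pos hl _).ne']
    exact one_div_le_one_div_of_le hpow (by linarith)

end SubstitutionDatum

end SymbolicSubstitution

theorem mainTheorem2 {G : Type*} [Group G] [MetricSpace G] {A : Type*}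
    (𝒟 : SymbolicSubstitution.DilationDatum G)
    (𝒮 : SymbolicSubstitution.SubstitutionDatum 𝒟 A) (hprim : 𝒮.IsPrimitive) :
    ∃ C : ℝ, 0 < C ∧ ∃ M₁ : ℝ, 0 ≤ M₁ ∧
      ∀ ω₀ : SymbolicSubstitution.Config 𝒟.Γ A, 𝒮.IsConvergent ω₀ →
        ∀ n : ℕ, M₁ ≤ (n : ℝ) →
          Metric.hausdorffDist
            (SymbolicSubstitution.orbitClosure (𝒮.substConfig^[n] ω₀)) 𝒮.subshift
            ≤ C / 𝒮.l₀ ^ n :=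
  𝒮.exists_hausdorffDist_le hprim
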